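/- Let $p\ge 3$ be a prime, and let $L$ be either $\mathbf Q_p$ or an unramified quadratic extension of $\mathbf Q_p$, with $|\cdot|_p$ the unique extension of the $p$-adic absolute value to $L$, $\nu_p=-\log_p|\cdot|_p$ and $\mathcal O_L=\{x\in L:|x|_p\le 1\}$; congruences modulo $p^m$ are taken modulo $p^m\mathcal O_L$. Let $(a_n)_{n\ge0}$ be a second-order linear recurrence sequence with terms and coefficients in $\mathbf Q_p$, given by $a_n=c_1\lambda_1^n+c_2\lambda_2^n$ with non-zero $c_1,c_2,\lambda_1,\lambda_2\in L$. Its Kepler set $K$ is the closure in $\mathbf Q_p$ of $\{a_{n+1}/a_n : n\ge 0,\ a_n\ne 0\}$. Suppose that $|\lambda_1|_p=|\lambda_2|_p$ and that $\lambda_2/\lambda_1$ is not a root of unity. Let $l$ be the order of $\lambda_2/\lambda_1$ modulo $p$, i.e. the least integer $l\ge 1$ with $(\lambda_2/\lambda_1)^l\equiv 1\pmod p$, and let $k=\nu_p\big((\lambda_2/\lambda_1)^l-1\big)$. Let $\Omega$ be the closure in $L$ of $\{(\lambda_2/\lambda_1)^n : n\ge 0\}$. (1) If $-c_1/c_2\notin\Omega$,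 then $a_i\ne0$ for $0\le i\le l-1$, and $K$ is the disjoint union $$K=\bigsqcup_{i=0}^{l-1}\left(\frac{a_{i+1}}{a_i}+p^{\,\nu_p(c_1/c_2)+\nu_p(\lambda_2-\lambda_1)-2\nu_p\left(c_1/c_2+(\lambda_2/\lambda_1)^i\right)+k}\,\mathbf Z_p\right).$$ (2) If $-c_1/c_2\in\Omega$ and $l=1$, then $(\lambda_1+\lambda_2)/2\in\mathbf Q_p$ and $$K=\mathbf Q_p\setminus\left(\frac{\lambda_1+\lambda_2}{2}+p^{\,1+\nu_p(\lambda_2)}\mathbf Z_p\right).$$ (3) If $-c_1/c_2\in\Omega$ and $l\ge2$, then there is a unique $s\in\{0,1,\dots,l-1\}$ with $(\lambda_2/\lambda_1)^s\equiv -c_1/c_2\pmod{p^k}$; for this $s$ one has $a_i\neq 0$ for all $0\le i\le l-1$ with $i\ne s$, and $K$ is the disjoint union $$K=\bigsqcup_{\substack{0\le i\le l-1\\ i\ne s}}\left(\frac{a_{i+1}}{a_i}+p^{\,\nu_p(\lambda_2-\lambda_1)+k}\,\mathbf Z_p\right)\ \sqcup\ \left(\mathbf Q_p\setminus p^{\,\nu_p(\lambda_2)+1-k}\,\mathbf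 Z_p\right).$$ -/

import Mathlib

/-- The Kepler set of a sequence: the closure of the set of its consecutive ratios
`a (n+1) / a n`, taken over those `n` for which the ratio is defined, that is, `a n ≠ 0`. -/
def keplerSet {F : Type*} [Field F] [TopologicalSpace F] (a : ℕ → F) : Set F :=
  closure {x | ∃ n : ℕ, a n ≠ 0 ∧ x = a (n + 1) / a n}

/-- `L` is an unramified quadratic extension of `ℚ_[p]`: it has degree two, and no element of `L`
has absolute value `p ^ (-1/2)`. The norm of a normed field that is a normed algebra over `ℚ_[p]`
is multiplicative and extends the `p`-adic absolute value, so on an extension of finite degree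
it is the unique extension `|·|_p`. -/
def IsUnramifiedQuadratic (p : ℕ) [Fact p.Prime] (L : Type*) [NormedField L]
    [NormedAlgebra ℚ_[p] L] : Prop :=
  Module.finrank ℚ_[p] L = 2 ∧ ¬ ∃ π : L, ‖π‖ = (p : ℝ) ^ (-(1 / 2) : ℝ)

/-- The valuation `ν_p (x) = - log_p |x|_p` of a nonzero element `x` of `ℚ_[p]` or of an unramified
extension, where nonzero absolute values are integral powers of `p` (see `nuP_eq`).
It is only used for nonzero `x`. -/
noncomputable def nuP (p : ℕ) {L : Type*} [NormedField L] (x : L) : ℤ :=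
  -Int.log p ‖x‖

theorem nuP_eq (p : ℕ) [hp : Fact p.Prime] {L : Type*} [NormedField L] (x : L) (n : ℤ)
    (h : ‖x‖ = (p : ℝ) ^ (-n)) : nuP p x = n := by
  rw [nuP, h, Int.log_zpow hp.out.one_lt, neg_neg]

/-- `x ≡ y (mod p ^ m)`: the difference lies in `p ^ m * O`, where `O` is the ring of
elements of absolute value at most `1`. -/
def CongrModPow (p : ℕ) {L : Type*} [NormedField L] (m : ℤ) (x y : L) : Prop :=
  ∃ w : L, ‖w‖ ≤ 1 ∧ x - y = (p : L) ^ m * w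

/-- `l` is the order of `u` modulo `p`: the least positive integer `n` with
`u ^ n ≡ 1 (mod p)`. -/
def IsOrderModP (p : ℕ) {L : Type*} [NormedField L] (u : L) (l : ℕ) : Prop :=
  IsLeast {n : ℕ | 0 < n ∧ CongrModPow p 1 (u ^ n) 1} l

/-- The ball `x + p ^ m ℤ_p` in `ℚ_p`. -/
def padicBall (p : ℕ) [Fact p.Prime] (x : ℚ_[p]) (m : ℤ) : Set ℚ_[p] :=
  {y | ∃ z : ℤ_[p], y = x + (p : ℚ_[p]) ^ m * (z : ℚ_[p])}

/-!
The ratio `a (n + 1) / a n` is the value at `u ^ n`, where `u = lam₂ / lam₁`, of the Möbius map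
`f x = (c * lam₁ + lam₂ * x) / (c + x)` with `c = c₁ / c₂` and pole `-c`. Hence the Kepler set is
governed by the closure `Ω` of the powers of `u`, and the proof has two halves.

*Description of `Ω` near a power of `u`.* Call quotients `(x + y * lam₂) / (x + y * lam₁)` with
`x`, `y` in `ℚ_p` quotients of conjugates (`IsConjQuot`); they form a group that contains `u`, `-c`
and the `f`-preimages of all points of `ℚ_p` other than `lam₁` and `lam₂`. With `q = ‖u ^ l - 1‖`,
which is less than `1`, every quotient of conjugates within distance `q` of `u ^ i` is a limit of
powers of `u` (`IsKeplerData.exists_pow_sub_lt`). By division it is enough to take `i = 0`. Near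
`1`, the Cayley transform `v ↦ (v - 1) / ((lam₂ - lam₁) * (v + 1))` is a similarity, with values in
`ℚ_p` on quotients of conjugates, and for odd `p` the map `n ↦ (u ^ l) ^ n` is a similarity for the
`p`-adic metric on `ℕ` (`norm_pow_sub_pow`). So the Cayley transforms of the powers of `u ^ l` are
a similar copy of `ℕ` in `ℚ_p`, and counting residue classes shows that such a copy is dense in the
ball that it generates (`Padic.exists_norm_sub_lt_of_similarity`). This argument needs neither
completeness of `L`, nor Galois theory, nor the `p`-adic logarithm, and treats roots in `ℚ_p` and
conjugate roots alike.

*Transport by `f`.* Since `f x - f y = c * (lam₂ - lam₁) * (x - y) / ((c + x) * (c + y))`, a ball of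
radius `q` around `u ^ i` that does not contain the pole corresponds to a ball around
`a (i + 1) / a i`, while the ball that contains the pole corresponds to the complement of a ball
around the midpoint `r / 2` of `lam₁` and `lam₂`, because
`f x - r / 2 = (lam₂ - lam₁) * (x - c) / (2 * (c + x))`. The pole lies in `Ω` exactly if it lies in
one of the balls around `1, u, …, u ^ (l - 1)` (`IsKeplerData.neg_mem_closure_iff`). The Kepler set
is the union of the `l` pieces (`IsKeplerData.keplerSet_eq_of_lt`,
`IsKeplerData.keplerSet_eq_of_le`).

That `L` has degree one or is unramified of degree two enters only through the fact that all nonzero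
norms are integral powers of `p` (`norm_eq_zpow_neg_nuP`); as a consequence incongruent powers of
`u` are at distance exactly `1`, and the pieces are disjoint.
-/

/-! ### Ultrametric norms and powers of principal units -/

lemma norm_eq_of_norm_sub_lt {E : Type*} [NormedField E] [IsUltrametricDist E] {x y : E}
    (h : ‖x - y‖ < ‖y‖) : ‖x‖ = ‖y‖ := by
  have h1 := IsUltrametricDist.norm_add_eq_max_of_norm_ne_norm h.ne
  rwa [sub_add_cancel, max_eq_right h.le] at h1

lemma norm_add_le_of_le_of_le {E : Type*} [NormedField E] [IsUltrametricDist E] {x y : E} {b : ℝ}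
    (hx : ‖x‖ ≤ b) (hy : ‖y‖ ≤ b) : ‖x + y‖ ≤ b :=
  (IsUltrametricDist.norm_add_le_max x y).trans (max_le hx hy)

lemma norm_sub_le_of_le_of_le {E : Type*} [NormedField E] [IsUltrametricDist E] {x y : E} {b : ℝ}
    (hx : ‖x‖ ≤ b) (hy : ‖y‖ ≤ b) : ‖x - y‖ ≤ b := by
  rw [sub_eq_add_neg]
  exact norm_add_le_of_le_of_le hx (by rwa [norm_neg])

lemma isUltrametricDist_of_normedAlgebra_padic (p : ℕ) [Fact p.Prime] (L : Type*) [NormedField L]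
    [NormedAlgebra ℚ_[p] L] : IsUltrametricDist L := by
  apply IsUltrametricDist.isUltrametricDist_of_forall_norm_natCast_le_one
  intro n
  rw [← map_natCast (algebraMap ℚ_[p] L), norm_algebraMap']
  exact IsUltrametricDist.norm_natCast_le_one ℚ_[p] n

section

variable {p : ℕ} [hp : Fact p.Prime] {L : Type*} [NormedField L] [NormedAlgebra ℚ_[p] L]

variable (p L) in
lemma norm_natCast_eq_padic (n : ℕ) : ‖(n : L)‖ = ‖(n : ℚ_[p])‖ := by
  rw [← map_natCast (algebraMap ℚ_[p] L), norm_algebraMap']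

variable (p) in
lemma norm_two_eq_one (h3 : 3 ≤ p) : ‖(2 : L)‖ = 1 := by
  have h := norm_natCast_eq_padic p L 2
  rw [Nat.cast_ofNat] at h
  rw [h, Padic.norm_natCast_eq_one_iff]
  exact (Nat.coprime_primes hp.out Nat.prime_two).2 (by omega)

variable [IsUltrametricDist L]

lemma norm_eq_one_of_norm_sub_one_lt {w : L} (hw : ‖w - 1‖ < 1) : ‖w‖ = 1 := by
  rw [norm_eq_of_norm_sub_lt (y := (1 : L)) (by rwa [norm_one]), norm_one]

lemma norm_pow_sub_one_le {w : L} (hw : ‖w‖ = 1) (n : ℕ) : ‖w ^ n - 1‖ ≤ ‖w - 1‖ := by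
  rw [← mul_geom_sum w n, norm_mul]
  refine mul_le_of_le_one_right (norm_nonneg _) ?_
  refine IsUltrametricDist.norm_sum_le_of_forall_le_of_nonneg zero_le_one fun i _ => ?_
  rw [norm_pow, hw, one_pow]

/-- First-order expansion of a power of a principal unit. -/
lemma norm_pow_sub_one_sub_le {w : L} (hw : ‖w‖ = 1) (n : ℕ) :
    ‖w ^ n - 1 - n * (w - 1)‖ ≤ ‖w - 1‖ ^ 2 := by
  induction n with
  | zero => simp
  | succ n ih =>
    have e : w ^ (n + 1) - 1 - ((n + 1 : ℕ) : L) * (w - 1)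
        = (w ^ n - 1 - n * (w - 1)) * w + n * (w - 1) ^ 2 := by push_cast; ring
    rw [e]
    refine norm_add_le_of_le_of_le (by rwa [norm_mul, hw, mul_one]) ?_
    rw [norm_mul, norm_pow]
    exact mul_le_of_le_one_left (by positivity) (IsUltrametricDist.norm_natCast_le_one L n)

lemma norm_pow_sub_one_of_coprime {w : L} (hw : ‖w - 1‖ < 1) {n : ℕ} (hn : p.Coprime n) :
    ‖w ^ n - 1‖ = ‖w - 1‖ := by
  have hw1 := norm_eq_one_of_norm_sub_one_lt hw
  have hn1 : ‖(n : L)‖ = 1 := by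
    rw [norm_natCast_eq_padic p L, Padic.norm_natCast_eq_one_iff]; exact hn
  rcases eq_or_ne w 1 with rfl | hne
  · simp
  have h0 : 0 < ‖w - 1‖ := norm_pos_iff.2 (sub_ne_zero.2 hne)
  have e : ‖(n : L) * (w - 1)‖ = ‖w - 1‖ := by rw [norm_mul, hn1, one_mul]
  rw [← e]
  apply norm_eq_of_norm_sub_lt
  rw [e]
  refine (norm_pow_sub_one_sub_le hw1 n).trans_lt ?_
  nlinarith

/-- The `p`-th power of a principal unit, for odd `p`: the second-order term
`p * (p - 1) / 2 * (w - 1)` of the geometric sum is negligible against `p`. -/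
lemma norm_pow_prime_sub_one (h3 : 3 ≤ p) {w : L} (hw : ‖w - 1‖ ≤ (p : ℝ)⁻¹) :
    ‖w ^ p - 1‖ = ‖w - 1‖ * (p : ℝ)⁻¹ := by
  have hp0 : (0 : ℝ) < p := by exact_mod_cast hp.out.pos
  have hpi : (p : ℝ)⁻¹ < 1 := inv_lt_one_of_one_lt₀ (by exact_mod_cast hp.out.one_lt)
  have hpi0 : 0 < (p : ℝ)⁻¹ := inv_pos.2 hp0
  have hw1 := norm_eq_one_of_norm_sub_one_lt (hw.trans_lt hpi)
  have hpn : ‖(p : L)‖ = (p : ℝ)⁻¹ := by rw [norm_natCast_eq_padic p L, Padic.norm_p]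
  rw [← mul_geom_sum w p, norm_mul, mul_comm]
  rw [mul_comm _ (p : ℝ)⁻¹]
  congr 1
  rw [← hpn]
  apply norm_eq_of_norm_sub_lt
  have hsum : ‖∑ i ∈ Finset.range p, (i : L)‖ ≤ (p : ℝ)⁻¹ := by
    have h2 : (∑ i ∈ Finset.range p, (i : L)) * 2 = p * ((p - 1 : ℕ) : L) := by
      have := Finset.sum_range_id_mul_two p
      have h := congrArg (Nat.cast : ℕ → L) this
      rwa [Nat.cast_mul, Nat.cast_mul, Nat.cast_sum, Nat.cast_ofNat] at h
    have h2' := congrArg norm h2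
    rw [norm_mul, norm_mul, norm_two_eq_one p h3, mul_one, hpn] at h2'
    rw [h2']
    exact mul_le_of_le_one_right hpi0.le (IsUltrametricDist.norm_natCast_le_one L _)
  have e : ∑ i ∈ Finset.range p, w ^ i - (p : L)
      = (∑ i ∈ Finset.range p, (w ^ i - 1 - i * (w - 1)))
        + (∑ i ∈ Finset.range p, (i : L)) * (w - 1) := by
    rw [Finset.sum_sub_distrib, Finset.sum_sub_distrib, ← Finset.sum_mul]
    simp
  have hle : ‖∑ i ∈ Finset.range p, w ^ i - (p : L)‖ ≤ (p : ℝ)⁻¹ * (p : ℝ)⁻¹ := by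
    rw [e]
    refine norm_add_le_of_le_of_le ?_ ?_
    · refine IsUltrametricDist.norm_sum_le_of_forall_le_of_nonneg (by positivity) fun i _ => ?_
      refine (norm_pow_sub_one_sub_le hw1 i).trans ?_
      rw [sq]
      exact mul_le_mul hw hw (norm_nonneg _) hpi0.le
    · rw [norm_mul]
      exact mul_le_mul hsum hw (norm_nonneg _) hpi0.le
  rw [hpn]
  refine hle.trans_lt ?_
  nlinarith

lemma norm_pow_sub_one (h3 : 3 ≤ p) (n : ℕ) {w : L} (hw : ‖w - 1‖ ≤ (p : ℝ)⁻¹) :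
    ‖w ^ n - 1‖ = ‖w - 1‖ * ‖(n : ℚ_[p])‖ := by
  have hpi : (p : ℝ)⁻¹ < 1 := inv_lt_one_of_one_lt₀ (by exact_mod_cast hp.out.one_lt)
  have hpi0 : 0 ≤ (p : ℝ)⁻¹ := by positivity
  induction n using Nat.strong_induction_on generalizing w with
  | _ n ih =>
    by_cases hn : p.Coprime n
    · rw [norm_pow_sub_one_of_coprime (hw.trans_lt hpi) hn, Padic.norm_natCast_eq_one_iff.2 hn,
        mul_one]
    · obtain ⟨e, rfl⟩ : p ∣ n := by
        by_contra h
        exact hn ((Nat.Prime.coprime_iff_not_dvd hp.out).2 h)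
      rcases Nat.eq_zero_or_pos e with rfl | he
      · simp
      · have h1 := norm_pow_prime_sub_one h3 hw
        rw [pow_mul, ih e (by nlinarith) (h1.trans_le ?_), h1, Nat.cast_mul, norm_mul, Padic.norm_p,
          mul_assoc]
        exact (mul_le_of_le_one_right (norm_nonneg _) hpi.le).trans hw

/-- For odd `p`, exponentiation with a base `w ≡ 1 (mod p)` scales the `p`-adic metric of the
exponents by `‖w - 1‖`. -/
lemma norm_pow_sub_pow (h3 : 3 ≤ p) {w : L} (hw : ‖w - 1‖ ≤ (p : ℝ)⁻¹) (n m : ℕ) :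
    ‖w ^ n - w ^ m‖ = ‖w - 1‖ * ‖(n : ℚ_[p]) - m‖ := by
  have hpi : (p : ℝ)⁻¹ < 1 := inv_lt_one_of_one_lt₀ (by exact_mod_cast hp.out.one_lt)
  have hw1 := norm_eq_one_of_norm_sub_one_lt (hw.trans_lt hpi)
  wlog h : m ≤ n generalizing n m with H
  · rw [norm_sub_rev, H m n (by omega), norm_sub_rev (m : ℚ_[p])]
  obtain ⟨d, rfl⟩ := Nat.exists_eq_add_of_le h
  have e : w ^ (m + d) - w ^ m = w ^ m * (w ^ d - 1) := by ring
  rw [e, norm_mul, norm_pow, hw1, one_pow, one_mul, norm_pow_sub_one h3 d hw]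
  congr 2
  push_cast; ring

end

/-! ### Density of similar copies of the natural numbers -/

/-- A map `ℕ → ℤ_p` that preserves `p`-adic distances has dense range: modulo `p ^ j` it is
injective on `{0, …, p ^ j - 1}`, hence surjective by counting. -/
lemma PadicInt.exists_norm_sub_lt_of_isometry {p : ℕ} [hp : Fact p.Prime] (h : ℕ → ℤ_[p])
    (hh : ∀ n m : ℕ, ‖h n - h m‖ = ‖(n : ℤ_[p]) - m‖) (y : ℤ_[p]) {δ : ℝ} (hδ : 0 < δ) :
    ∃ n, ‖h n - y‖ < δ := by
  obtain ⟨j, hj⟩ := PadicInt.exists_pow_neg_lt p hδ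
  have key : ∀ x z : ℤ_[p], PadicInt.toZModPow j x = PadicInt.toZModPow j z ↔
      ‖x - z‖ ≤ (p : ℝ) ^ (-(j : ℤ)) := fun x z => by
    rw [PadicInt.norm_le_pow_iff_mem_span_pow, ← PadicInt.ker_toZModPow, RingHom.mem_ker, map_sub,
      sub_eq_zero]
  have : NeZero (p ^ j) := ⟨(pow_pos hp.out.pos j).ne'⟩
  have hinj : Function.Injective fun z : ZMod (p ^ j) => PadicInt.toZModPow j (h z.val) := by
    intro z z' hz
    have h1 := (key _ _).1 hz
    rw [hh, ← key] at h1
    simpa using h1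
  obtain ⟨z, hz⟩ := (Finite.injective_iff_surjective.1 hinj) (PadicInt.toZModPow j y)
  exact ⟨z.val, ((key _ _).1 hz).trans_lt hj⟩

/-- The image of a similarity `ℕ → ℚ_p`, for the `p`-adic metric on `ℕ`, is dense in the ball that
it generates. -/
lemma Padic.exists_norm_sub_lt_of_similarity {p : ℕ} [hp : Fact p.Prime] (h : ℕ → ℚ_[p]) {R : ℝ}
    (hR : 0 < R) (hh : ∀ n m : ℕ, ‖h n - h m‖ = R * ‖(n : ℚ_[p]) - m‖) (y : ℚ_[p])
    (hy : ‖y - h 0‖ ≤ R) {δ : ℝ} (hδ : 0 < δ) : ∃ n, ‖h n - y‖ < δ := by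
  set d := h 1 - h 0 with hd
  have hdR : ‖d‖ = R := by rw [hd, hh]; simp
  have lift : ∀ x : ℚ_[p], ‖x‖ ≤ 1 → ∃ z : ℤ_[p], (z : ℚ_[p]) = x := fun x hx => ⟨⟨x, hx⟩, rfl⟩
  have hH : ∀ n, ∃ z : ℤ_[p], (z : ℚ_[p]) = (h n - h 0) / d := fun n => lift _ <| by
    rw [norm_div, hdR, div_le_one hR, hh]
    refine mul_le_of_le_one_right hR.le ?_
    simpa using IsUltrametricDist.norm_natCast_le_one ℚ_[p] n
  choose H hH using hH
  obtain ⟨Y, hY⟩ := lift ((y - h 0) / d) (by rwa [norm_div, hdR, div_le_one hR])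
  obtain ⟨n, hn⟩ := PadicInt.exists_norm_sub_lt_of_isometry H (fun n m => by
    rw [PadicInt.norm_def, PadicInt.norm_def, PadicInt.coe_sub, PadicInt.coe_sub,
      PadicInt.coe_natCast, PadicInt.coe_natCast, hH, hH, ← sub_div, norm_div, hdR,
      sub_sub_sub_cancel_right, hh, mul_div_cancel_left₀ _ hR.ne']) Y (div_pos hδ hR)
  refine ⟨n, ?_⟩
  rw [PadicInt.norm_def, PadicInt.coe_sub, hH, hY, ← sub_div, norm_div, hdR,
    div_lt_div_iff_of_pos_right hR, sub_sub_sub_cancel_right] at hn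
  exact hn

/-! ### Quotients of conjugates -/

/-- `v` is a quotient `(x + y * lam₂) / (x + y * lam₁)` with `x`, `y` in `ℚ_p`. If `lam₁` and `lam₂`
are conjugate over `ℚ_p` but not in `ℚ_p`, these are the elements of relative norm one in
`ℚ_p(lam₁)`; if both lie in `ℚ_p` and are distinct, every nonzero element of `ℚ_p` is such
a quotient. -/
def IsConjQuot (p : ℕ) [Fact p.Prime] {L : Type*} [NormedField L] [NormedAlgebra ℚ_[p] L]
    (lam₁ lam₂ v : L) : Prop :=
  ∃ x y : ℚ_[p], algebraMap ℚ_[p] L x + algebraMap ℚ_[p] L y * lam₁ ≠ 0 ∧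
    algebraMap ℚ_[p] L x + algebraMap ℚ_[p] L y * lam₂ ≠ 0 ∧
    v = (algebraMap ℚ_[p] L x + algebraMap ℚ_[p] L y * lam₂) /
      (algebraMap ℚ_[p] L x + algebraMap ℚ_[p] L y * lam₁)

section

variable {p : ℕ} [hp : Fact p.Prime] {L : Type*} [NormedField L] [NormedAlgebra ℚ_[p] L]
  {lam₁ lam₂ : L} {r s : ℚ_[p]}

lemma IsConjQuot.mul (hadd : lam₁ + lam₂ = algebraMap ℚ_[p] L r)
    (hmul : lam₁ * lam₂ = -algebraMap ℚ_[p] L s) {v w : L}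
    (hv : IsConjQuot p lam₁ lam₂ v) (hw : IsConjQuot p lam₁ lam₂ w) :
    IsConjQuot p lam₁ lam₂ (v * w) := by
  obtain ⟨x, y, h1, h2, rfl⟩ := hv
  obtain ⟨x', y', h1', h2', rfl⟩ := hw
  have e1 : algebraMap ℚ_[p] L (x * x' + y * y' * s) +
      algebraMap ℚ_[p] L (x * y' + x' * y + y * y' * r) * lam₁ =
      (algebraMap ℚ_[p] L x + algebraMap ℚ_[p] L y * lam₁) *
        (algebraMap ℚ_[p] L x' + algebraMap ℚ_[p] L y' * lam₁) := by
    simp only [map_add, map_mul]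
    linear_combination (-(algebraMap ℚ_[p] L y * algebraMap ℚ_[p] L y' * lam₁)) * hadd
      + (algebraMap ℚ_[p] L y * algebraMap ℚ_[p] L y') * hmul
  have e2 : algebraMap ℚ_[p] L (x * x' + y * y' * s) +
      algebraMap ℚ_[p] L (x * y' + x' * y + y * y' * r) * lam₂ =
      (algebraMap ℚ_[p] L x + algebraMap ℚ_[p] L y * lam₂) *
        (algebraMap ℚ_[p] L x' + algebraMap ℚ_[p] L y' * lam₂) := by
    simp only [map_add, map_mul]
    linear_combination (-(algebraMap ℚ_[p] L y * algebraMap ℚ_[p] L y' * lam₂)) * hadd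
      + (algebraMap ℚ_[p] L y * algebraMap ℚ_[p] L y') * hmul
  refine ⟨x * x' + y * y' * s, x * y' + x' * y + y * y' * r, ?_, ?_, ?_⟩
  · rw [e1]; exact mul_ne_zero h1 h1'
  · rw [e2]; exact mul_ne_zero h2 h2'
  · rw [e1, e2, div_mul_div_comm]

lemma IsConjQuot.inv (hadd : lam₁ + lam₂ = algebraMap ℚ_[p] L r) {v : L}
    (hv : IsConjQuot p lam₁ lam₂ v) : IsConjQuot p lam₁ lam₂ v⁻¹ := by
  obtain ⟨x, y, h1, h2, rfl⟩ := hv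
  have e1 : algebraMap ℚ_[p] L (x + y * r) + algebraMap ℚ_[p] L (-y) * lam₁ =
      algebraMap ℚ_[p] L x + algebraMap ℚ_[p] L y * lam₂ := by
    simp only [map_add, map_mul, map_neg]
    linear_combination (-(algebraMap ℚ_[p] L y)) * hadd
  have e2 : algebraMap ℚ_[p] L (x + y * r) + algebraMap ℚ_[p] L (-y) * lam₂ =
      algebraMap ℚ_[p] L x + algebraMap ℚ_[p] L y * lam₁ := by
    simp only [map_add, map_mul, map_neg]
    linear_combination (-(algebraMap ℚ_[p] L y)) * hadd
  refine ⟨x + y * r, -y, ?_, ?_, ?_⟩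
  · rwa [e1]
  · rwa [e2]
  · rw [e1, e2, inv_div]

lemma IsConjQuot.one : IsConjQuot p lam₁ lam₂ 1 := ⟨1, 0, by simp, by simp, by simp⟩

lemma IsConjQuot.pow (hadd : lam₁ + lam₂ = algebraMap ℚ_[p] L r)
    (hmul : lam₁ * lam₂ = -algebraMap ℚ_[p] L s) {v : L}
    (hv : IsConjQuot p lam₁ lam₂ v) (n : ℕ) : IsConjQuot p lam₁ lam₂ (v ^ n) := by
  induction n with
  | zero => simpa using IsConjQuot.one
  | succ n ih => rw [pow_succ]; exact ih.mul hadd hmul hv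

lemma isConjQuot_div (h1 : lam₁ ≠ 0) (h2 : lam₂ ≠ 0) : IsConjQuot p lam₁ lam₂ (lam₂ / lam₁) :=
  ⟨0, 1, by simpa, by simpa, by simp⟩

/-- The Cayley transform `v ↦ (v - 1) / ((lam₂ - lam₁) * (v + 1))` takes quotients of conjugates
to `ℚ_p`. -/
lemma IsConjQuot.exists_cayley (hadd : lam₁ + lam₂ = algebraMap ℚ_[p] L r) (hne : lam₂ - lam₁ ≠ 0)
    {v : L} (hv : IsConjQuot p lam₁ lam₂ v) (hv1 : v + 1 ≠ 0) :
    ∃ z : ℚ_[p], algebraMap ℚ_[p] L z = (v - 1) / ((lam₂ - lam₁) * (v + 1)) := by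
  obtain ⟨x, y, h1, h2, rfl⟩ := hv
  refine ⟨y / (2 * x + y * r), ?_⟩
  have e : algebraMap ℚ_[p] L (2 * x + y * r) =
      ((algebraMap ℚ_[p] L x + algebraMap ℚ_[p] L y * lam₂) /
        (algebraMap ℚ_[p] L x + algebraMap ℚ_[p] L y * lam₁) + 1) *
        (algebraMap ℚ_[p] L x + algebraMap ℚ_[p] L y * lam₁) := by
    rw [add_mul, div_mul_cancel₀ _ h1]
    simp only [map_add, map_mul, map_ofNat]
    linear_combination (-(algebraMap ℚ_[p] L y)) * hadd
  rw [map_div₀, e, div_eq_div_iff (mul_ne_zero hv1 h1) (mul_ne_zero hne hv1)]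
  generalize hX : algebraMap ℚ_[p] L x + algebraMap ℚ_[p] L y * lam₁ = X at *
  have e2 : algebraMap ℚ_[p] L x + algebraMap ℚ_[p] L y * lam₂
      = X + algebraMap ℚ_[p] L y * (lam₂ - lam₁) := by rw [← hX]; ring
  rw [e2]
  field_simp
  ring

/-- The powers of a quotient of conjugates `w ≡ 1 (mod p)` are dense among the quotients of
conjugates that are as close to `1` as `w` is: the Cayley transform is a similarity near `1`, and it
turns the powers of `w` into a similar copy of `ℕ` in `ℚ_p`. -/
lemma IsConjQuot.exists_pow_sub_lt [IsUltrametricDist L] (h3 : 3 ≤ p)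
    (hadd : lam₁ + lam₂ = algebraMap ℚ_[p] L r)
    (hmul : lam₁ * lam₂ = -algebraMap ℚ_[p] L s) (hne : lam₂ - lam₁ ≠ 0) {v w : L}
    (hv : IsConjQuot p lam₁ lam₂ v) (hw : IsConjQuot p lam₁ lam₂ w)
    (hw1 : w ≠ 1) (hwp : ‖w - 1‖ ≤ (p : ℝ)⁻¹) (hvw : ‖v - 1‖ ≤ ‖w - 1‖) {δ : ℝ} (hδ : 0 < δ) :
    ∃ n : ℕ, ‖w ^ n - v‖ < δ := by
  have hpi : (p : ℝ)⁻¹ < 1 := inv_lt_one_of_one_lt₀ (by exact_mod_cast hp.out.one_lt)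
  have hw0 : 0 < ‖w - 1‖ := norm_pos_iff.2 (sub_ne_zero.2 hw1)
  have hwn := norm_eq_one_of_norm_sub_one_lt (hwp.trans_lt hpi)
  have hD : 0 < ‖lam₂ - lam₁‖ := norm_pos_iff.2 hne
  have two := norm_two_eq_one (L := L) p h3
  have hpow : ∀ n : ℕ, ‖w ^ n - 1‖ ≤ ‖w - 1‖ := fun n => norm_pow_sub_one_le hwn n
  have add_one : ∀ t : L, ‖t - 1‖ ≤ ‖w - 1‖ → ‖t + 1‖ = 1 := fun t ht => by
    rw [← two]
    apply norm_eq_of_norm_sub_lt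
    rw [two]
    have e : t + 1 - 2 = t - 1 := by ring
    rw [e]
    exact ht.trans_lt (hwp.trans_lt hpi)
  have ne : ∀ t : L, ‖t - 1‖ ≤ ‖w - 1‖ → t + 1 ≠ 0 := fun t ht =>
    norm_pos_iff.1 (by rw [add_one t ht]; exact one_pos)
  -- the Cayley transform scales distances near `1` by `‖lam₂ - lam₁‖⁻¹`
  have sim : ∀ (t t' : L) (z z' : ℚ_[p]), ‖t - 1‖ ≤ ‖w - 1‖ → ‖t' - 1‖ ≤ ‖w - 1‖ →
      algebraMap ℚ_[p] L z = (t - 1) / ((lam₂ - lam₁) * (t + 1)) →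
      algebraMap ℚ_[p] L z' = (t' - 1) / ((lam₂ - lam₁) * (t' + 1)) →
      ‖z - z'‖ = ‖t - t'‖ / ‖lam₂ - lam₁‖ := by
    intro t t' z z' ht ht' hz hz'
    have h1 := ne t ht
    have h2 := ne t' ht'
    have e : algebraMap ℚ_[p] L (z - z') =
        2 * (t - t') / ((lam₂ - lam₁) * ((t + 1) * (t' + 1))) := by
      rw [map_sub, hz, hz']
      field_simp
      ring
    rw [← norm_algebraMap' L, e, norm_div, norm_mul, norm_mul, norm_mul, two, add_one t ht,
      add_one t' ht', one_mul, mul_one, mul_one]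
  have hex : ∀ n : ℕ, ∃ z : ℚ_[p],
      algebraMap ℚ_[p] L z = (w ^ n - 1) / ((lam₂ - lam₁) * (w ^ n + 1)) := fun n =>
    (hw.pow hadd hmul n).exists_cayley hadd hne (ne _ (hpow n))
  choose h hh using hex
  obtain ⟨z, hz⟩ := hv.exists_cayley hadd hne (ne _ hvw)
  obtain ⟨n, hn⟩ := Padic.exists_norm_sub_lt_of_similarity h
    (R := ‖w - 1‖ / ‖lam₂ - lam₁‖) (div_pos hw0 hD) (fun n m => by
      rw [sim _ _ _ _ (hpow n) (hpow m) (hh n) (hh m), norm_pow_sub_pow h3 hwp, div_mul_eq_mul_div])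
    z (by
      rw [sim _ _ _ _ hvw (hpow 0) hz (hh 0), pow_zero]
      exact div_le_div_of_nonneg_right hvw hD.le) (div_pos hδ hD)
  refine ⟨n, ?_⟩
  rwa [sim _ _ _ _ (hpow n) hvw (hh n) hz, div_lt_div_iff_of_pos_right hD] at hn

end

/-! ### Consecutive ratios of a binary recurrence -/

/-- The sequence `a` in `ℚ_p` has the terms `a n = d * lam₁ ^ n * (c + (lam₂ / lam₁) ^ n)` with
nonzero `c` and `d`, where `lam₁` and `lam₂` are the roots of `X ^ 2 - r * X - s`, nonzero and of
equal norms, and `l ≥ 1` is such that `(lam₂ / lam₁) ^ l` is congruent to `1` modulo the odd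
prime `p`, but is not `1`. -/
structure IsKeplerData (p : ℕ) [Fact p.Prime] {L : Type*} [NormedField L] [NormedAlgebra ℚ_[p] L]
    (a : ℕ → ℚ_[p]) (r s : ℚ_[p]) (c d lam₁ lam₂ : L) (l : ℕ) : Prop where
  three_le : 3 ≤ p
  c_ne : c ≠ 0
  d_ne : d ≠ 0
  lam₁_ne : lam₁ ≠ 0
  lam₂_ne : lam₂ ≠ 0
  add : lam₁ + lam₂ = algebraMap ℚ_[p] L r
  mul : lam₁ * lam₂ = -algebraMap ℚ_[p] L s
  term : ∀ n, algebraMap ℚ_[p] L (a n) = d * lam₁ ^ n * (c + (lam₂ / lam₁) ^ n)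
  norm_eq : ‖lam₁‖ = ‖lam₂‖
  l_pos : 0 < l
  pow_ne : (lam₂ / lam₁) ^ l ≠ 1
  pow_le : ‖(lam₂ / lam₁) ^ l - 1‖ ≤ (p : ℝ)⁻¹

namespace IsKeplerData

variable {p : ℕ} [hp : Fact p.Prime] {L : Type*} [NormedField L] [NormedAlgebra ℚ_[p] L]
  {a : ℕ → ℚ_[p]} {r s : ℚ_[p]} {c d lam₁ lam₂ : L} {l : ℕ}

lemma sub_ne (H : IsKeplerData p a r s c d lam₁ lam₂ l) : lam₂ - lam₁ ≠ 0 := fun h => by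
  apply H.pow_ne
  rw [sub_eq_zero.1 h, div_self H.lam₁_ne, one_pow]

lemma norm_quot (H : IsKeplerData p a r s c d lam₁ lam₂ l) : ‖lam₂ / lam₁‖ = 1 := by
  rw [norm_div, H.norm_eq, div_self (norm_ne_zero_iff.2 H.lam₂_ne)]

lemma norm_quot_pow (H : IsKeplerData p a r s c d lam₁ lam₂ l) (n : ℕ) :
    ‖(lam₂ / lam₁) ^ n‖ = 1 := by
  rw [norm_pow, H.norm_quot, one_pow]

lemma quot_ne (H : IsKeplerData p a r s c d lam₁ lam₂ l) : lam₂ / lam₁ ≠ 0 :=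
  div_ne_zero H.lam₂_ne H.lam₁_ne

lemma radius_lt (H : IsKeplerData p a r s c d lam₁ lam₂ l) : ‖(lam₂ / lam₁) ^ l - 1‖ < 1 :=
  H.pow_le.trans_lt (inv_lt_one_of_one_lt₀ (by exact_mod_cast hp.out.one_lt))

lemma radius_pos (H : IsKeplerData p a r s c d lam₁ lam₂ l) : 0 < ‖(lam₂ / lam₁) ^ l - 1‖ :=
  norm_pos_iff.2 (sub_ne_zero.2 H.pow_ne)

lemma ne_zero_iff (H : IsKeplerData p a r s c d lam₁ lam₂ l) (n : ℕ) :
    a n ≠ 0 ↔ c + (lam₂ / lam₁) ^ n ≠ 0 := by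
  have h : d * lam₁ ^ n ≠ 0 := mul_ne_zero H.d_ne (pow_ne_zero _ H.lam₁_ne)
  rw [← (algebraMap ℚ_[p] L).injective.ne_iff, map_zero, H.term, mul_ne_zero_iff]
  exact and_iff_right h

/-- Consecutive ratios are the values of the Möbius map
`x ↦ (c * lam₁ + lam₂ * x) / (c + x)` at the powers of `lam₂ / lam₁`. -/
lemma ratio (H : IsKeplerData p a r s c d lam₁ lam₂ l) {n : ℕ} (hn : c + (lam₂ / lam₁) ^ n ≠ 0) :
    algebraMap ℚ_[p] L (a (n + 1) / a n) =
      (c * lam₁ + lam₂ * (lam₂ / lam₁) ^ n) / (c + (lam₂ / lam₁) ^ n) := by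
  have h : d * lam₁ ^ n ≠ 0 := mul_ne_zero H.d_ne (pow_ne_zero _ H.lam₁_ne)
  have e : lam₂ = lam₁ * (lam₂ / lam₁) := by rw [mul_div_cancel₀ _ H.lam₁_ne]
  rw [map_div₀, H.term, H.term, div_eq_div_iff (mul_ne_zero h hn) hn]
  generalize lam₂ / lam₁ = u at *
  rw [e]
  ring

lemma norm_ratio_sub (H : IsKeplerData p a r s c d lam₁ lam₂ l) {n m : ℕ}
    (hn : c + (lam₂ / lam₁) ^ n ≠ 0) (hm : c + (lam₂ / lam₁) ^ m ≠ 0) :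
    ‖a (n + 1) / a n - a (m + 1) / a m‖ =
      ‖c‖ * ‖lam₂ - lam₁‖ * ‖(lam₂ / lam₁) ^ n - (lam₂ / lam₁) ^ m‖ /
        (‖c + (lam₂ / lam₁) ^ n‖ * ‖c + (lam₂ / lam₁) ^ m‖) := by
  rw [← norm_algebraMap' L, map_sub, H.ratio hn, H.ratio hm, ← norm_mul, ← norm_mul, ← norm_mul,
    ← norm_div]
  congr 1
  rw [div_sub_div _ _ hn hm]
  congr 1
  ring

lemma norm_sub_ratio (H : IsKeplerData p a r s c d lam₁ lam₂ l) {n : ℕ}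
    (hn : c + (lam₂ / lam₁) ^ n ≠ 0) :
    ‖lam₂ - algebraMap ℚ_[p] L (a (n + 1) / a n)‖ =
      ‖c‖ * ‖lam₂ - lam₁‖ / ‖c + (lam₂ / lam₁) ^ n‖ := by
  rw [H.ratio hn, ← norm_mul, ← norm_div]
  congr 1
  field_simp
  ring

/-- `-c` is itself a quotient of conjugates, of `a 1 - a 0 * lam₂` and `a 1 - a 0 * lam₁`. -/
lemma isConjQuot_neg (H : IsKeplerData p a r s c d lam₁ lam₂ l) :
    IsConjQuot p lam₁ lam₂ (-c) := by
  have e : lam₁ * (lam₂ / lam₁) = lam₂ := by rw [mul_div_cancel₀ _ H.lam₁_ne]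
  have h0 := H.term 0
  have h1 := H.term 1
  rw [pow_zero, pow_zero, mul_one] at h0
  rw [pow_one, pow_one, mul_assoc, mul_add, e] at h1
  have e1 : algebraMap ℚ_[p] L (a 1) + algebraMap ℚ_[p] L (-(a 0)) * lam₁ =
      d * (lam₂ - lam₁) := by rw [map_neg, h0, h1]; ring
  have e2 : algebraMap ℚ_[p] L (a 1) + algebraMap ℚ_[p] L (-(a 0)) * lam₂ =
      -c * (d * (lam₂ - lam₁)) := by rw [map_neg, h0, h1]; ring
  have hne := mul_ne_zero H.d_ne H.sub_ne
  refine ⟨a 1, -(a 0), ?_, ?_, ?_⟩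
  · rwa [e1]
  · rw [e2]; exact mul_ne_zero (neg_ne_zero.2 H.c_ne) hne
  · rw [e1, e2, mul_div_cancel_right₀ _ hne]

variable [IsUltrametricDist L]

/-- A quotient of conjugates in the closed ball around `(lam₂ / lam₁) ^ i` whose radius is the
distance of `(lam₂ / lam₁) ^ l` from `1` is a limit of powers of `lam₂ / lam₁`. -/
lemma exists_pow_sub_lt (H : IsKeplerData p a r s c d lam₁ lam₂ l) {x : L}
    (hx : IsConjQuot p lam₁ lam₂ x) {i : ℕ}
    (hxi : ‖x - (lam₂ / lam₁) ^ i‖ ≤ ‖(lam₂ / lam₁) ^ l - 1‖) {δ : ℝ} (hδ : 0 < δ) :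
    ∃ n, ‖(lam₂ / lam₁) ^ n - x‖ < δ := by
  have hu := isConjQuot_div (p := p) H.lam₁_ne H.lam₂_ne
  have hui : (lam₂ / lam₁) ^ i ≠ 0 := pow_ne_zero _ H.quot_ne
  obtain ⟨n, hn⟩ := IsConjQuot.exists_pow_sub_lt H.three_le H.add H.mul H.sub_ne
    (v := x * ((lam₂ / lam₁) ^ i)⁻¹) (w := (lam₂ / lam₁) ^ l)
    (hx.mul H.add H.mul ((hu.pow H.add H.mul i).inv H.add)) (hu.pow H.add H.mul l)
    H.pow_ne H.pow_le (by
      have e : x * ((lam₂ / lam₁) ^ i)⁻¹ - 1 =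
          (x - (lam₂ / lam₁) ^ i) * ((lam₂ / lam₁) ^ i)⁻¹ := by
        rw [sub_mul, mul_inv_cancel₀ hui]
      rw [e, norm_mul, norm_inv, H.norm_quot_pow, inv_one, mul_one]
      exact hxi) hδ
  refine ⟨l * n + i, ?_⟩
  have e : (lam₂ / lam₁) ^ (l * n + i) - x =
      (((lam₂ / lam₁) ^ l) ^ n - x * ((lam₂ / lam₁) ^ i)⁻¹) * (lam₂ / lam₁) ^ i := by
    rw [sub_mul, inv_mul_cancel_right₀ hui, pow_add, pow_mul]
  rw [e, norm_mul, H.norm_quot_pow, mul_one]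
  exact hn

/-- A point `y` of `ℚ_p` belongs to the Kepler set as soon as its preimage
`c * (lam₁ - y) / (y - lam₂)` under the Möbius map is close enough to a power of `lam₂ / lam₁`. -/
lemma mem_keplerSet (H : IsKeplerData p a r s c d lam₁ lam₂ l) {y : ℚ_[p]}
    (hy : algebraMap ℚ_[p] L y - lam₂ ≠ 0) {i : ℕ}
    (hi : ‖c * (lam₁ - algebraMap ℚ_[p] L y) / (algebraMap ℚ_[p] L y - lam₂) -
      (lam₂ / lam₁) ^ i‖ ≤ ‖(lam₂ / lam₁) ^ l - 1‖) : y ∈ keplerSet a := by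
  set Y := algebraMap ℚ_[p] L y with hY
  set x := c * (lam₁ - Y) / (Y - lam₂) with hx
  have hy1 : Y - lam₁ ≠ 0 := fun h => by
    have h0 : x = 0 := by rw [hx, ← neg_sub, h]; simp
    rw [h0, zero_sub, norm_neg, H.norm_quot_pow] at hi
    exact absurd H.radius_lt (not_lt.2 hi)
  have hconj : IsConjQuot p lam₁ lam₂ x := by
    have h1 : IsConjQuot p lam₁ lam₂ ((Y - lam₂) / (Y - lam₁)) :=
      ⟨y, -1, by simpa [← sub_eq_add_neg], by simpa [← sub_eq_add_neg], by
        simp [← sub_eq_add_neg, hY]⟩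
    have h2 := H.isConjQuot_neg.mul H.add H.mul (h1.inv H.add)
    convert h2 using 1
    rw [hx, inv_div]
    ring
  have hcx : c + x = -c * (lam₂ - lam₁) / (Y - lam₂) := by
    rw [hx]; field_simp; ring
  have hcx0 : c + x ≠ 0 := by
    rw [hcx]
    exact div_ne_zero (mul_ne_zero (neg_ne_zero.2 H.c_ne) H.sub_ne) hy
  have hcxp := norm_pos_iff.2 hcx0
  have hyp := norm_pos_iff.2 hy
  refine Metric.mem_closure_iff.2 fun δ hδ => ?_
  obtain ⟨n, hn⟩ := H.exists_pow_sub_lt hconj hi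
    (lt_min hcxp (div_pos (mul_pos hδ hcxp) hyp))
  have hn1 := hn.trans_le (min_le_left _ _)
  have hn2 := hn.trans_le (min_le_right _ _)
  have hnorm : ‖c + (lam₂ / lam₁) ^ n‖ = ‖c + x‖ := by
    apply norm_eq_of_norm_sub_lt
    rwa [add_sub_add_left_eq_sub]
  have hne : c + (lam₂ / lam₁) ^ n ≠ 0 := norm_pos_iff.1 (hnorm ▸ hcxp)
  refine ⟨_, ⟨n, (H.ne_zero_iff n).2 hne, rfl⟩, ?_⟩
  have e : algebraMap ℚ_[p] L (y - a (n + 1) / a n) =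
      ((lam₂ / lam₁) ^ n - x) * (Y - lam₂) / (c + (lam₂ / lam₁) ^ n) := by
    have hxy : x * (Y - lam₂) = c * (lam₁ - Y) := by rw [hx, div_mul_cancel₀ _ hy]
    rw [map_sub, H.ratio hne, sub_mul, hxy, ← hY, eq_div_iff hne, sub_mul, div_mul_cancel₀ _ hne]
    ring
  rw [dist_eq_norm, ← norm_algebraMap' L, e, norm_div, norm_mul, hnorm, div_lt_iff₀ hcxp]
  rwa [lt_div_iff₀ hyp] at hn2

lemma norm_pow_sub_pow_mod_le (H : IsKeplerData p a r s c d lam₁ lam₂ l) (n : ℕ) :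
    ‖(lam₂ / lam₁) ^ n - (lam₂ / lam₁) ^ (n % l)‖ ≤ ‖(lam₂ / lam₁) ^ l - 1‖ := by
  have e : (lam₂ / lam₁) ^ n - (lam₂ / lam₁) ^ (n % l) =
      (lam₂ / lam₁) ^ (n % l) * (((lam₂ / lam₁) ^ l) ^ (n / l) - 1) := by
    rw [← pow_mul, mul_sub, ← pow_add, Nat.mod_add_div, mul_one]
  rw [e, norm_mul, H.norm_quot_pow, one_mul]
  exact norm_pow_sub_one_le (H.norm_quot_pow l) _

/-! ### Residue classes away from the pole -/

lemma norm_add_pow_eq (H : IsKeplerData p a r s c d lam₁ lam₂ l) {n : ℕ}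
    (hi : ‖(lam₂ / lam₁) ^ l - 1‖ < ‖c + (lam₂ / lam₁) ^ (n % l)‖) :
    ‖c + (lam₂ / lam₁) ^ n‖ = ‖c + (lam₂ / lam₁) ^ (n % l)‖ := by
  apply norm_eq_of_norm_sub_lt
  rw [add_sub_add_left_eq_sub]
  exact (H.norm_pow_sub_pow_mod_le n).trans_lt hi

lemma norm_ratio_sub_mod_le (H : IsKeplerData p a r s c d lam₁ lam₂ l) {n : ℕ}
    (hi : ‖(lam₂ / lam₁) ^ l - 1‖ < ‖c + (lam₂ / lam₁) ^ (n % l)‖) :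
    ‖a (n + 1) / a n - a (n % l + 1) / a (n % l)‖ ≤
      ‖c‖ * ‖lam₂ - lam₁‖ * ‖(lam₂ / lam₁) ^ l - 1‖ / ‖c + (lam₂ / lam₁) ^ (n % l)‖ ^ 2 := by
  have h0 := H.radius_pos.trans hi
  rw [H.norm_ratio_sub (norm_pos_iff.1 (H.norm_add_pow_eq hi ▸ h0)) (norm_pos_iff.1 h0),
    H.norm_add_pow_eq hi, ← sq]
  gcongr
  exact H.norm_pow_sub_pow_mod_le n

/-- The Kepler set contains the ball that the ratios with index in the residue class of `i`
generate. -/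
lemma mem_keplerSet_of_norm_sub_le (H : IsKeplerData p a r s c d lam₁ lam₂ l) {i : ℕ}
    (hi : ‖(lam₂ / lam₁) ^ l - 1‖ < ‖c + (lam₂ / lam₁) ^ i‖) {y : ℚ_[p]}
    (hy : ‖y - a (i + 1) / a i‖ ≤
      ‖c‖ * ‖lam₂ - lam₁‖ * ‖(lam₂ / lam₁) ^ l - 1‖ / ‖c + (lam₂ / lam₁) ^ i‖ ^ 2) :
    y ∈ keplerSet a := by
  have h0 := H.radius_pos.trans hi
  have hne := norm_pos_iff.1 h0
  have hcD : 0 < ‖c‖ * ‖lam₂ - lam₁‖ := mul_pos (norm_pos_iff.2 H.c_ne) (norm_pos_iff.2 H.sub_ne)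
  have hnorm : ‖algebraMap ℚ_[p] L y - lam₂‖ =
      ‖c‖ * ‖lam₂ - lam₁‖ / ‖c + (lam₂ / lam₁) ^ i‖ := by
    rw [← H.norm_sub_ratio hne, norm_sub_rev lam₂]
    apply norm_eq_of_norm_sub_lt
    rw [sub_sub_sub_cancel_right, ← map_sub, norm_algebraMap', norm_sub_rev _ lam₂,
      H.norm_sub_ratio hne]
    refine hy.trans_lt ?_
    rw [div_lt_div_iff₀ (by positivity) h0, sq]
    nlinarith [mul_lt_mul_of_pos_left hi (mul_pos hcD h0)]
  have hpos : 0 < ‖algebraMap ℚ_[p] L y - lam₂‖ := hnorm ▸ div_pos hcD h0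
  have hy2 := norm_pos_iff.1 hpos
  refine H.mem_keplerSet hy2 (i := i) ?_
  have e : c * (lam₁ - algebraMap ℚ_[p] L y) / (algebraMap ℚ_[p] L y - lam₂) -
      (lam₂ / lam₁) ^ i = -(algebraMap ℚ_[p] L (y - a (i + 1) / a i) *
        (c + (lam₂ / lam₁) ^ i)) / (algebraMap ℚ_[p] L y - lam₂) := by
    rw [map_sub, H.ratio hne, sub_mul, div_mul_cancel₀ _ hne, eq_div_iff hy2, sub_mul,
      div_mul_cancel₀ _ hy2]
    ring
  rw [e, norm_div, norm_neg, norm_mul, norm_algebraMap', hnorm]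
  calc _ ≤ ‖c‖ * ‖lam₂ - lam₁‖ * ‖(lam₂ / lam₁) ^ l - 1‖ / ‖c + (lam₂ / lam₁) ^ i‖ ^ 2 *
        ‖c + (lam₂ / lam₁) ^ i‖ / (‖c‖ * ‖lam₂ - lam₁‖ / ‖c + (lam₂ / lam₁) ^ i‖) := by gcongr
    _ = ‖(lam₂ / lam₁) ^ l - 1‖ := by
      have h1 := norm_ne_zero_iff.2 H.c_ne
      have h2 := norm_ne_zero_iff.2 H.sub_ne
      field_simp

/-- The balls belonging to two residue classes are far apart when the powers of `lam₂ / lam₁` are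
incongruent: the centres are further from each other than the radius of either. -/
lemma lt_norm_ratio_sub (H : IsKeplerData p a r s c d lam₁ lam₂ l) {i j : ℕ}
    (hi : ‖(lam₂ / lam₁) ^ l - 1‖ < ‖c + (lam₂ / lam₁) ^ i‖)
    (hj : ‖(lam₂ / lam₁) ^ l - 1‖ < ‖c + (lam₂ / lam₁) ^ j‖)
    (hij : ‖(lam₂ / lam₁) ^ i - (lam₂ / lam₁) ^ j‖ = 1) :
    ‖c‖ * ‖lam₂ - lam₁‖ * ‖(lam₂ / lam₁) ^ l - 1‖ / ‖c + (lam₂ / lam₁) ^ i‖ ^ 2 <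
      ‖a (i + 1) / a i - a (j + 1) / a j‖ := by
  have hi0 := H.radius_pos.trans hi
  have hj0 := H.radius_pos.trans hj
  have hcD : 0 < ‖c‖ * ‖lam₂ - lam₁‖ := mul_pos (norm_pos_iff.2 H.c_ne) (norm_pos_iff.2 H.sub_ne)
  have key : ‖(lam₂ / lam₁) ^ l - 1‖ * ‖c + (lam₂ / lam₁) ^ j‖ < ‖c + (lam₂ / lam₁) ^ i‖ := by
    rcases lt_or_ge 1 ‖c + (lam₂ / lam₁) ^ j‖ with h | h
    · rw [← norm_eq_of_norm_sub_lt (x := c + (lam₂ / lam₁) ^ i) (y := c + (lam₂ / lam₁) ^ j)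
        (by rwa [add_sub_add_left_eq_sub, hij])]
      exact mul_lt_of_lt_one_left hi0 H.radius_lt
    · exact (mul_le_of_le_one_right (norm_nonneg _) h).trans_lt hi
  rw [H.norm_ratio_sub (norm_pos_iff.1 hi0) (norm_pos_iff.1 hj0), hij, mul_one,
    div_lt_div_iff₀ (by positivity) (by positivity), sq]
  nlinarith [mul_lt_mul_of_pos_left key (mul_pos hcD hi0)]

/-! ### The residue class of the pole -/

lemma norm_c_eq_one (H : IsKeplerData p a r s c d lam₁ lam₂ l) {t : ℕ}
    (ht : ‖c + (lam₂ / lam₁) ^ t‖ ≤ ‖(lam₂ / lam₁) ^ l - 1‖) : ‖c‖ = 1 := by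
  rw [norm_eq_of_norm_sub_lt (x := c) (y := -(lam₂ / lam₁) ^ t), norm_neg, H.norm_quot_pow]
  rw [sub_neg_eq_add, norm_neg, H.norm_quot_pow]
  exact ht.trans_lt H.radius_lt

/-- The ratios in the residue class of the pole stay away from the midpoint of `lam₁`, `lam₂`. -/
lemma le_norm_ratio_sub_half (H : IsKeplerData p a r s c d lam₁ lam₂ l) {n : ℕ}
    (ht : ‖c + (lam₂ / lam₁) ^ (n % l)‖ ≤ ‖(lam₂ / lam₁) ^ l - 1‖) (hn : a n ≠ 0) :
    ‖lam₂ - lam₁‖ / ‖(lam₂ / lam₁) ^ l - 1‖ ≤ ‖a (n + 1) / a n - r / 2‖ := by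
  have hne := (H.ne_zero_iff n).1 hn
  have two := norm_two_eq_one (L := L) p H.three_le
  have two0 : (2 : L) ≠ 0 := norm_ne_zero_iff.1 (by rw [two]; exact one_ne_zero)
  have hle : ‖c + (lam₂ / lam₁) ^ n‖ ≤ ‖(lam₂ / lam₁) ^ l - 1‖ := by
    have e : c + (lam₂ / lam₁) ^ n = c + (lam₂ / lam₁) ^ (n % l) +
      ((lam₂ / lam₁) ^ n - (lam₂ / lam₁) ^ (n % l)) := by ring
    rw [e]
    exact norm_add_le_of_le_of_le ht (H.norm_pow_sub_pow_mod_le n)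
  have e : algebraMap ℚ_[p] L (a (n + 1) / a n - r / 2) =
      (lam₂ - lam₁) * ((lam₂ / lam₁) ^ n - c) / (2 * (c + (lam₂ / lam₁) ^ n)) := by
    rw [map_sub, H.ratio hne, map_div₀, map_ofNat, ← H.add, div_sub_div _ _ hne two0,
      mul_comm (2 : L)]
    congr 1
    ring
  have h1 : ‖(lam₂ / lam₁) ^ n - c‖ = 1 := by
    have h2 : ‖(2 : L) * (lam₂ / lam₁) ^ n‖ = 1 := by
      rw [norm_mul, two, H.norm_quot_pow, mul_one]
    rw [← h2]
    apply norm_eq_of_norm_sub_lt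
    have e' : (lam₂ / lam₁) ^ n - c - 2 * (lam₂ / lam₁) ^ n = -(c + (lam₂ / lam₁) ^ n) := by ring
    rw [e', norm_neg, h2]
    exact hle.trans_lt H.radius_lt
  rw [← norm_algebraMap' L (_ - r / 2), e, norm_div, norm_mul, norm_mul, two, h1, one_mul, mul_one]
  exact div_le_div_of_nonneg_left (norm_nonneg _) (norm_pos_iff.2 hne) hle

/-- The Kepler set contains a neighbourhood of infinity when the pole of the Möbius map is close to
a power of `lam₂ / lam₁`. -/
lemma mem_keplerSet_of_le_norm_sub_half (H : IsKeplerData p a r s c d lam₁ lam₂ l) {t : ℕ}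
    (ht : ‖c + (lam₂ / lam₁) ^ t‖ ≤ ‖(lam₂ / lam₁) ^ l - 1‖) {y : ℚ_[p]}
    (hy : ‖lam₂ - lam₁‖ / ‖(lam₂ / lam₁) ^ l - 1‖ ≤ ‖y - r / 2‖) : y ∈ keplerSet a := by
  have two := norm_two_eq_one (L := L) p H.three_le
  have two0 : (2 : L) ≠ 0 := norm_ne_zero_iff.1 (by rw [two]; exact one_ne_zero)
  have hD : 0 < ‖lam₂ - lam₁‖ := norm_pos_iff.2 H.sub_ne
  have hq := H.radius_pos
  have hlt : ‖lam₂ - lam₁‖ < ‖y - r / 2‖ := by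
    refine lt_of_lt_of_le ?_ hy
    rw [lt_div_iff₀ hq]
    exact mul_lt_of_lt_one_right hD H.radius_lt
  have hnorm : ‖algebraMap ℚ_[p] L y - lam₂‖ = ‖y - r / 2‖ := by
    rw [← norm_algebraMap' L (y - r / 2)]
    apply norm_eq_of_norm_sub_lt
    have e : algebraMap ℚ_[p] L y - lam₂ - algebraMap ℚ_[p] L (y - r / 2) =
        -((lam₂ - lam₁) / 2) := by
      rw [map_sub, map_div₀, map_ofNat, ← H.add]
      field_simp
      ring
    rwa [e, norm_neg, norm_div, two, div_one, norm_algebraMap']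
  have hpos : 0 < ‖algebraMap ℚ_[p] L y - lam₂‖ := by rw [hnorm]; exact hD.trans hlt
  have hy2 := norm_pos_iff.1 hpos
  refine H.mem_keplerSet hy2 (i := t) ?_
  have e : c * (lam₁ - algebraMap ℚ_[p] L y) / (algebraMap ℚ_[p] L y - lam₂) - (lam₂ / lam₁) ^ t =
      -(c * (lam₂ - lam₁)) / (algebraMap ℚ_[p] L y - lam₂) - (c + (lam₂ / lam₁) ^ t) := by
    have : c * (lam₁ - algebraMap ℚ_[p] L y) =
        -(c * (lam₂ - lam₁)) - c * (algebraMap ℚ_[p] L y - lam₂) := by ring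
    rw [this, sub_div, mul_div_cancel_right₀ _ hy2]
    ring
  rw [e]
  refine norm_sub_le_of_le_of_le ?_ ht
  rw [norm_div, norm_neg, norm_mul, H.norm_c_eq_one ht, one_mul, hnorm,
    div_le_iff₀ (hD.trans hlt)]
  rwa [div_le_iff₀' hq] at hy

/-- The pole `-c` is a limit of powers of `lam₂ / lam₁` exactly when it is close to one of them. -/
lemma neg_mem_closure_iff (H : IsKeplerData p a r s c d lam₁ lam₂ l) :
    -c ∈ closure (Set.range fun n : ℕ => (lam₂ / lam₁) ^ n) ↔
      ∃ i < l, ‖c + (lam₂ / lam₁) ^ i‖ ≤ ‖(lam₂ / lam₁) ^ l - 1‖ := by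
  have e : ∀ n, -c - (lam₂ / lam₁) ^ n = -(c + (lam₂ / lam₁) ^ n) := fun n => by ring
  constructor
  · intro h
    obtain ⟨_, ⟨n, rfl⟩, hn⟩ := Metric.mem_closure_iff.1 h _ H.radius_pos
    rw [dist_eq_norm, e, norm_neg] at hn
    refine ⟨n % l, Nat.mod_lt _ H.l_pos, ?_⟩
    have e2 : c + (lam₂ / lam₁) ^ (n % l) = c + (lam₂ / lam₁) ^ n -
      ((lam₂ / lam₁) ^ n - (lam₂ / lam₁) ^ (n % l)) := by ring
    rw [e2]
    exact norm_sub_le_of_le_of_le hn.le (H.norm_pow_sub_pow_mod_le n)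
  · rintro ⟨i, -, hi⟩
    refine Metric.mem_closure_iff.2 fun δ hδ => ?_
    obtain ⟨n, hn⟩ := H.exists_pow_sub_lt H.isConjQuot_neg (i := i)
      (by rwa [e, norm_neg]) hδ
    exact ⟨_, ⟨n, rfl⟩, by rwa [dist_comm, dist_eq_norm]⟩

/-! ### The Kepler set as a finite union -/

/-- The Kepler set when the pole is far from all powers of `lam₂ / lam₁`. -/
theorem keplerSet_eq_of_lt (H : IsKeplerData p a r s c d lam₁ lam₂ l)
    (h : ∀ i < l, ‖(lam₂ / lam₁) ^ l - 1‖ < ‖c + (lam₂ / lam₁) ^ i‖) :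
    keplerSet a = ⋃ i ∈ {i : ℕ | i < l}, Metric.closedBall (a (i + 1) / a i)
      (‖c‖ * ‖lam₂ - lam₁‖ * ‖(lam₂ / lam₁) ^ l - 1‖ / ‖c + (lam₂ / lam₁) ^ i‖ ^ 2) := by
  apply subset_antisymm
  · refine closure_minimal ?_
      ((Set.finite_lt_nat l).isClosed_biUnion fun i _ => Metric.isClosed_closedBall)
    rintro _ ⟨n, -, rfl⟩
    have hl := Nat.mod_lt n H.l_pos
    refine Set.mem_biUnion (x := n % l) hl ?_
    rw [mem_closedBall_iff_norm]
    exact H.norm_ratio_sub_mod_le (h _ hl)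
  · refine Set.iUnion₂_subset fun i hi y hy => ?_
    rw [mem_closedBall_iff_norm] at hy
    exact H.mem_keplerSet_of_norm_sub_le (h i hi) hy

/-- The Kepler set when the pole is close to `(lam₂ / lam₁) ^ t`. -/
theorem keplerSet_eq_of_le (H : IsKeplerData p a r s c d lam₁ lam₂ l) {t : ℕ}
    (ht : ‖c + (lam₂ / lam₁) ^ t‖ ≤ ‖(lam₂ / lam₁) ^ l - 1‖)
    (h : ∀ i < l, i ≠ t → ‖(lam₂ / lam₁) ^ l - 1‖ < ‖c + (lam₂ / lam₁) ^ i‖) :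
    keplerSet a = (⋃ i ∈ {i : ℕ | i < l ∧ i ≠ t}, Metric.closedBall (a (i + 1) / a i)
      (‖c‖ * ‖lam₂ - lam₁‖ * ‖(lam₂ / lam₁) ^ l - 1‖ / ‖c + (lam₂ / lam₁) ^ i‖ ^ 2)) ∪
      {y | ‖lam₂ - lam₁‖ / ‖(lam₂ / lam₁) ^ l - 1‖ ≤ ‖y - r / 2‖} := by
  apply subset_antisymm
  · refine closure_minimal ?_ (IsClosed.union
      (((Set.finite_lt_nat l).subset fun i hi => hi.1).isClosed_biUnion
        fun i _ => Metric.isClosed_closedBall)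
      (isClosed_le continuous_const (by fun_prop)))
    rintro _ ⟨n, hn, rfl⟩
    have hl := Nat.mod_lt n H.l_pos
    by_cases hnt : n % l = t
    · exact Or.inr (H.le_norm_ratio_sub_half (hnt.symm ▸ ht) hn)
    · refine Or.inl (Set.mem_biUnion (x := n % l) ⟨hl, hnt⟩ ?_)
      rw [mem_closedBall_iff_norm]
      exact H.norm_ratio_sub_mod_le (h _ hl hnt)
  · refine Set.union_subset (Set.iUnion₂_subset fun i hi y hy => ?_) fun y hy =>
      H.mem_keplerSet_of_le_norm_sub_half ht hy
    rw [mem_closedBall_iff_norm] at hy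
    exact H.mem_keplerSet_of_norm_sub_le (h i hi.1 hi.2) hy

theorem disjoint_closedBall (H : IsKeplerData p a r s c d lam₁ lam₂ l) {i j : ℕ}
    (hi : ‖(lam₂ / lam₁) ^ l - 1‖ < ‖c + (lam₂ / lam₁) ^ i‖)
    (hj : ‖(lam₂ / lam₁) ^ l - 1‖ < ‖c + (lam₂ / lam₁) ^ j‖)
    (hij : ‖(lam₂ / lam₁) ^ i - (lam₂ / lam₁) ^ j‖ = 1) :
    Disjoint
      (Metric.closedBall (a (i + 1) / a i)
        (‖c‖ * ‖lam₂ - lam₁‖ * ‖(lam₂ / lam₁) ^ l - 1‖ / ‖c + (lam₂ / lam₁) ^ i‖ ^ 2))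
      (Metric.closedBall (a (j + 1) / a j)
        (‖c‖ * ‖lam₂ - lam₁‖ * ‖(lam₂ / lam₁) ^ l - 1‖ / ‖c + (lam₂ / lam₁) ^ j‖ ^ 2)) := by
  rw [Set.disjoint_left]
  intro y hy hy'
  rw [mem_closedBall_iff_norm] at hy hy'
  have h1 := hy.trans_lt (H.lt_norm_ratio_sub hi hj hij)
  have h2 := hy'.trans_lt (H.lt_norm_ratio_sub hj hi (by rwa [norm_sub_rev]))
  have e : a (i + 1) / a i - a (j + 1) / a j =
    (y - a (j + 1) / a j) - (y - a (i + 1) / a i) := by ring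
  rw [norm_sub_rev (a (j + 1) / a j)] at h2
  have h3 := norm_sub_le_of_le_of_le (le_max_left ‖y - a (j + 1) / a j‖ ‖y - a (i + 1) / a i‖)
    (le_max_right _ _)
  rw [← e] at h3
  exact absurd (max_lt h2 h1) (not_lt.2 h3)

end IsKeplerData

/-! ### Values of the norm on unramified extensions -/

/-- Three terms with sum zero: two of them have equal norms. -/
lemma exists_norm_eq_of_add_eq_zero {E : Type*} [NormedField E] [IsUltrametricDist E] {x y z : E}
    (h : x + y + z = 0) (hne : x ≠ 0 ∨ y ≠ 0 ∨ z ≠ 0) :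
    (‖x‖ = ‖y‖ ∧ x ≠ 0) ∨ (‖x‖ = ‖z‖ ∧ x ≠ 0) ∨ (‖y‖ = ‖z‖ ∧ y ≠ 0) := by
  have hz : ‖z‖ = ‖x + y‖ := by rw [eq_neg_of_add_eq_zero_right h, norm_neg]
  by_cases hxy : ‖x‖ = ‖y‖
  · by_cases hx : x = 0
    · subst hx
      have hy : y = 0 := norm_eq_zero.1 (by rw [← hxy, norm_zero])
      subst hy
      simp_all
    · exact Or.inl ⟨hxy, hx⟩
  · rw [IsUltrametricDist.norm_add_eq_max_of_norm_ne_norm hxy] at hz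
    rcases lt_or_gt_of_ne hxy with hlt | hlt
    · rw [max_eq_right hlt.le] at hz
      exact Or.inr (Or.inr ⟨hz.symm, norm_pos_iff.1 ((norm_nonneg _).trans_lt hlt)⟩)
    · rw [max_eq_left hlt.le] at hz
      exact Or.inr (Or.inl ⟨hz.symm, norm_pos_iff.1 ((norm_nonneg _).trans_lt hlt)⟩)

/-- In an extension of degree two the square of the norm of a nonzero element is an integral power
of `p`: two of the three terms of a quadratic equation for the element have equal norms. -/
lemma exists_norm_sq_eq_zpow {p : ℕ} [hp : Fact p.Prime] {L : Type*} [NormedField L]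
    [NormedAlgebra ℚ_[p] L] [IsUltrametricDist L] (hL : Module.finrank ℚ_[p] L = 2) {x : L}
    (hx : x ≠ 0) : ∃ m : ℤ, ‖x‖ ^ 2 = (p : ℝ) ^ m := by
  have hp0 : (p : ℝ) ≠ 0 := by exact_mod_cast hp.out.ne_zero
  have hfin : Module.Finite ℚ_[p] L := Module.finite_of_finrank_pos (by omega)
  have hx0 : ‖x‖ ≠ 0 := norm_ne_zero_iff.2 hx
  have hdep : ¬ LinearIndependent ℚ_[p] ![(1 : L), x, x ^ 2] := fun h => by
    have := h.fintype_card_le_finrank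
    rw [hL, Fintype.card_fin] at this
    omega
  obtain ⟨g, hg, j, hj⟩ := Fintype.not_linearIndependent_iff.1 hdep
  rw [Fin.sum_univ_three] at hg
  simp only [Matrix.cons_val_zero, Matrix.cons_val_one, Matrix.cons_val] at hg
  have hne : g 0 • (1 : L) ≠ 0 ∨ g 1 • x ≠ 0 ∨ g 2 • x ^ 2 ≠ 0 := by
    fin_cases j
    · exact Or.inl (smul_ne_zero hj one_ne_zero)
    · exact Or.inr (Or.inl (smul_ne_zero hj hx))
    · exact Or.inr (Or.inr (smul_ne_zero hj (pow_ne_zero 2 hx)))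
  have val : ∀ i j : Fin 3, ∀ y z : L, g i • y ≠ 0 → z ≠ 0 → ‖g i • y‖ = ‖g j • z‖ →
      ∃ m : ℤ, ‖z‖ = (p : ℝ) ^ m * ‖y‖ := by
    intro i j y z hi hz h
    have hgi : g i ≠ 0 := fun h0 => hi (by rw [h0, zero_smul])
    have hgj : g j ≠ 0 := fun h0 => by
      rw [h0, zero_smul, norm_zero, norm_eq_zero] at h
      exact hi h
    rw [norm_smul, norm_smul, Padic.norm_eq_zpow_neg_valuation hgi,
      Padic.norm_eq_zpow_neg_valuation hgj] at h
    refine ⟨-(g i).valuation - -(g j).valuation, ?_⟩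
    rw [zpow_sub₀ hp0, div_mul_eq_mul_div, h, mul_div_cancel_left₀ _ (zpow_ne_zero _ hp0)]
  rcases exists_norm_eq_of_add_eq_zero hg hne with ⟨h, h0⟩ | ⟨h, h0⟩ | ⟨h, h0⟩
  · obtain ⟨m, hm⟩ := val _ _ _ _ h0 hx h
    rw [norm_one, mul_one] at hm
    exact ⟨m * (2 : ℕ), by rw [hm, zpow_mul, zpow_natCast]⟩
  · obtain ⟨m, hm⟩ := val _ _ _ _ h0 (pow_ne_zero 2 hx) h
    rw [norm_one, mul_one, norm_pow] at hm
    exact ⟨m, hm⟩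
  · obtain ⟨m, hm⟩ := val _ _ _ _ h0 (pow_ne_zero 2 hx) h
    rw [norm_pow, sq, mul_left_inj' hx0] at hm
    exact ⟨m * (2 : ℕ), by rw [hm, zpow_mul, zpow_natCast]⟩

lemma norm_eq_zpow_neg_nuP {p : ℕ} [hp : Fact p.Prime] {L : Type*} [NormedField L]
    [NormedAlgebra ℚ_[p] L] [IsUltrametricDist L]
    (hL : Module.finrank ℚ_[p] L = 1 ∨ IsUnramifiedQuadratic p L) {x : L} (hx : x ≠ 0) :
    ‖x‖ = (p : ℝ) ^ (-nuP p x) := by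
  have hp0 : (0 : ℝ) < p := by exact_mod_cast hp.out.pos
  suffices h : ∃ n : ℤ, ‖x‖ = (p : ℝ) ^ n by
    obtain ⟨n, hn⟩ := h
    rw [nuP_eq p x (-n) (by rw [neg_neg, hn]), neg_neg, hn]
  rcases hL with hL | ⟨hL, hram⟩
  · obtain ⟨y, rfl⟩ := (finrank_eq_one_iff_of_nonzero' (1 : L) one_ne_zero).1 hL x
    have hy : y ≠ 0 := fun h => hx (by rw [h, zero_smul])
    exact ⟨-y.valuation, by rw [norm_smul, norm_one, mul_one, Padic.norm_eq_zpow_neg_valuation hy]⟩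
  · obtain ⟨m, hm⟩ := exists_norm_sq_eq_zpow hL hx
    rcases Int.even_or_odd' m with ⟨n, rfl | rfl⟩
    · refine ⟨n, ?_⟩
      rw [mul_comm, zpow_mul, zpow_ofNat] at hm
      exact (pow_left_inj₀ (norm_nonneg _) (zpow_nonneg hp0.le _) two_ne_zero).1 hm
    · -- an odd exponent would rescale to an element of norm `p ^ (-1 / 2)`
      refine absurd ⟨x * (p : L) ^ (n + 1), ?_⟩ hram
      have hpn : ‖(p : L)‖ = (p : ℝ)⁻¹ := by rw [norm_natCast_eq_padic p L, Padic.norm_p]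
      rw [norm_mul, norm_zpow, hpn]
      refine (pow_left_inj₀ (by positivity) (by positivity) two_ne_zero).1 ?_
      have hhalf : ((p : ℝ) ^ (-(1 / 2) : ℝ)) ^ 2 = (p : ℝ) ^ (-1 : ℤ) := by
        rw [← Real.rpow_natCast, ← Real.rpow_mul hp0.le, ← Real.rpow_intCast]
        norm_num
      rw [mul_pow, hm, hhalf, inv_zpow', ← zpow_natCast, ← zpow_mul, ← zpow_add₀ hp0.ne']
      congr 1
      push_cast
      ring

/-! ### Balls, congruences and valuations -/

section

variable {p : ℕ} [hp : Fact p.Prime]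

lemma padicBall_eq_closedBall (x : ℚ_[p]) (m : ℤ) :
    padicBall p x m = Metric.closedBall x ((p : ℝ) ^ (-m)) := by
  have hp0 : (p : ℚ_[p]) ≠ 0 := by exact_mod_cast hp.out.ne_zero
  have hpr : (0 : ℝ) < p := by exact_mod_cast hp.out.pos
  ext y
  rw [mem_closedBall_iff_norm]
  constructor
  · rintro ⟨z, rfl⟩
    rw [add_sub_cancel_left, norm_mul, Padic.norm_p_zpow]
    exact mul_le_of_le_one_right (zpow_nonneg hpr.le _) z.2
  · intro h
    refine ⟨⟨(y - x) / (p : ℚ_[p]) ^ m, ?_⟩, ?_⟩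
    · rw [norm_div, Padic.norm_p_zpow]
      exact div_le_one_of_le₀ h (zpow_nonneg hpr.le _)
    · change y = x + (p : ℚ_[p]) ^ m * ((y - x) / (p : ℚ_[p]) ^ m)
      rw [mul_div_cancel₀ _ (zpow_ne_zero _ hp0), add_sub_cancel]

lemma compl_padicBall_eq (x : ℚ_[p]) (m : ℤ) :
    (padicBall p x m)ᶜ = {y | (p : ℝ) ^ (1 - m) ≤ ‖y - x‖} := by
  ext y
  rw [padicBall_eq_closedBall, Set.mem_compl_iff, mem_closedBall_iff_norm,
    Padic.norm_le_pow_iff_norm_lt_pow_add_one, not_lt, neg_add_eq_sub]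
  rfl

lemma congrModPow_iff {L : Type*} [NormedField L] [NormedAlgebra ℚ_[p] L] (m : ℤ) (x y : L) :
    CongrModPow p m x y ↔ ‖x - y‖ ≤ (p : ℝ) ^ (-m) := by
  have hpr : (0 : ℝ) < p := by exact_mod_cast hp.out.pos
  have hpn : ‖(p : L)‖ = (p : ℝ)⁻¹ := by rw [norm_natCast_eq_padic p L, Padic.norm_p]
  have hp0 : (p : L) ≠ 0 := norm_ne_zero_iff.1 (by rw [hpn]; positivity)
  have hpm : ‖(p : L) ^ m‖ = (p : ℝ) ^ (-m) := by rw [norm_zpow, hpn, inv_zpow']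
  constructor
  · rintro ⟨w, hw, e⟩
    rw [e, norm_mul, hpm]
    exact mul_le_of_le_one_right (zpow_nonneg hpr.le _) hw
  · intro h
    refine ⟨(x - y) / (p : L) ^ m, ?_, (mul_div_cancel₀ _ (zpow_ne_zero _ hp0)).symm⟩
    rw [norm_div, hpm]
    exact div_le_one_of_le₀ h (zpow_nonneg hpr.le _)

/-- A sequence `c₁ * lam₁ ^ n + c₂ * lam₂ ^ n` with `lam₁ ≠ lam₂` and nonzero coefficients
determines the recurrence that it satisfies. -/
lemma add_mul_of_recurrence {L : Type*} [NormedField L] [NormedAlgebra ℚ_[p] L]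
    {a : ℕ → ℚ_[p]} {r s : ℚ_[p]} {c₁ c₂ lam₁ lam₂ : L}
    (hrec : ∀ n : ℕ, a (n + 2) = r * a (n + 1) + s * a n) (hc₁ : c₁ ≠ 0) (hc₂ : c₂ ≠ 0)
    (ha : ∀ n : ℕ, algebraMap ℚ_[p] L (a n) = c₁ * lam₁ ^ n + c₂ * lam₂ ^ n)
    (hne : lam₁ ≠ lam₂) :
    lam₁ + lam₂ = algebraMap ℚ_[p] L r ∧ lam₁ * lam₂ = -algebraMap ℚ_[p] L s := by
  have hne' := sub_ne_zero.2 hne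
  have h0 := congrArg (algebraMap ℚ_[p] L) (hrec 0)
  have h1 := congrArg (algebraMap ℚ_[p] L) (hrec 1)
  simp only [map_add, map_mul, ha] at h0 h1
  generalize algebraMap ℚ_[p] L r = R at *
  generalize algebraMap ℚ_[p] L s = S at *
  have e1 : lam₁ ^ 2 - R * lam₁ - S = 0 := by
    have : (c₁ * (lam₁ - lam₂)) * (lam₁ ^ 2 - R * lam₁ - S) = 0 := by
      linear_combination h1 - lam₂ * h0
    exact (mul_eq_zero.1 this).resolve_left (mul_ne_zero hc₁ hne')
  have e2 : lam₂ ^ 2 - R * lam₂ - S = 0 := by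
    have : (c₂ * (lam₁ - lam₂)) * (lam₂ ^ 2 - R * lam₂ - S) = 0 := by
      linear_combination lam₁ * h0 - h1
    exact (mul_eq_zero.1 this).resolve_left (mul_ne_zero hc₂ hne')
  have e3 : lam₁ + lam₂ = R := by
    have : (lam₁ - lam₂) * (lam₁ + lam₂ - R) = 0 := by linear_combination e1 - e2
    exact sub_eq_zero.1 ((mul_eq_zero.1 this).resolve_left hne')
  exact ⟨e3, by linear_combination lam₁ * e3 - e1⟩

variable {L : Type*} [NormedField L] [NormedAlgebra ℚ_[p] L] [IsUltrametricDist L]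

/-- Without ramification, an integral element that is not divisible by `p` is a unit. -/
lemma norm_eq_one_of_not_le_inv (hL : Module.finrank ℚ_[p] L = 1 ∨ IsUnramifiedQuadratic p L)
    {x : L} (h1 : ‖x‖ ≤ 1) (h2 : ¬ ‖x‖ ≤ (p : ℝ) ^ (-1 : ℤ)) : ‖x‖ = 1 := by
  have hp1 : (1 : ℝ) < p := by exact_mod_cast hp.out.one_lt
  have hx : x ≠ 0 := by
    rintro rfl
    exact h2 (by rw [norm_zero]; positivity)
  have e := norm_eq_zpow_neg_nuP hL hx
  rw [e] at h1 h2
  rw [zpow_le_one_iff_right₀ hp1] at h1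
  rw [zpow_le_zpow_iff_right₀ hp1] at h2
  rw [e, show -nuP p x = 0 by omega, zpow_zero]

/-- The powers of a unit below its order modulo `p` are pairwise incongruent. -/
lemma IsOrderModP.norm_pow_sub_pow_eq_one
    (hL : Module.finrank ℚ_[p] L = 1 ∨ IsUnramifiedQuadratic p L) {u : L} (hu : ‖u‖ = 1) {l : ℕ}
    (hl : IsOrderModP p u l) {i j : ℕ} (hi : i < l) (hj : j < l) (hij : i ≠ j) :
    ‖u ^ i - u ^ j‖ = 1 := by
  wlog h : j < i generalizing i j with H
  · rw [norm_sub_rev]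
    exact H hj hi hij.symm (by omega)
  have e : u ^ i - u ^ j = u ^ j * (u ^ (i - j) - 1) := by
    rw [mul_sub, ← pow_add, Nat.add_sub_cancel' h.le, mul_one]
  rw [e, norm_mul, norm_pow, hu, one_pow, one_mul]
  refine norm_eq_one_of_not_le_inv hL
    (norm_sub_le_of_le_of_le (by rw [norm_pow, hu, one_pow]) norm_one.le) fun hle => ?_
  have := hl.2 ⟨Nat.sub_pos_of_lt h, (congrModPow_iff 1 _ _).2 hle⟩
  omega

end

theorem mainTheorem1 (p : ℕ) [Fact p.Prime] (hp : 3 ≤ p)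
    (L : Type*) [NormedField L] [NormedAlgebra ℚ_[p] L]
    (hL : Module.finrank ℚ_[p] L = 1 ∨ IsUnramifiedQuadratic p L)
    (a : ℕ → ℚ_[p]) (r s : ℚ_[p]) (hrec : ∀ n : ℕ, a (n + 2) = r * a (n + 1) + s * a n)
    (c₁ c₂ lam₁ lam₂ : L) (hc₁ : c₁ ≠ 0) (hc₂ : c₂ ≠ 0) (hlam₁ : lam₁ ≠ 0) (hlam₂ : lam₂ ≠ 0)
    (ha : ∀ n : ℕ, algebraMap ℚ_[p] L (a n) = c₁ * lam₁ ^ n + c₂ * lam₂ ^ n)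
    (hnorm : ‖lam₁‖ = ‖lam₂‖)
    (hroot : ∀ n : ℕ, 0 < n → (lam₂ / lam₁) ^ n ≠ 1)
    (l : ℕ) (hl : IsOrderModP p (lam₂ / lam₁) l)
    (k : ℤ) (hk : k = nuP p ((lam₂ / lam₁) ^ l - 1)) :
    -- (1)
    (-(c₁ / c₂) ∉ closure (Set.range fun n : ℕ => (lam₂ / lam₁) ^ n) →
      ∀ B : ℕ → Set ℚ_[p], (∀ i, B i = padicBall p (a (i + 1) / a i)
        (nuP p (c₁ / c₂) + nuP p (lam₂ - lam₁) -
          2 * nuP p (c₁ / c₂ + (lam₂ / lam₁) ^ i) + k)) →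
      (∀ i < l, a i ≠ 0) ∧
      (∀ i < l, ∀ j < l, i ≠ j → Disjoint (B i) (B j)) ∧
      keplerSet a = ⋃ i ∈ {i : ℕ | i < l}, B i) ∧
    -- (2)
    (-(c₁ / c₂) ∈ closure (Set.range fun n : ℕ => (lam₂ / lam₁) ^ n) → l = 1 →
      ∃ m : ℚ_[p], algebraMap ℚ_[p] L m = (lam₁ + lam₂) / 2 ∧
        keplerSet a = (padicBall p m (1 + nuP p lam₂))ᶜ) ∧
    -- (3)
    (-(c₁ / c₂) ∈ closure (Set.range fun n : ℕ => (lam₂ / lam₁) ^ n) → 2 ≤ l →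
      (∃! t : ℕ, t < l ∧ CongrModPow p k ((lam₂ / lam₁) ^ t) (-(c₁ / c₂))) ∧
      ∀ t : ℕ, t < l → CongrModPow p k ((lam₂ / lam₁) ^ t) (-(c₁ / c₂)) →
        ∀ B : ℕ → Set ℚ_[p],
          (∀ i, B i = padicBall p (a (i + 1) / a i) (nuP p (lam₂ - lam₁) + k)) →
        ∀ C : Set ℚ_[p], C = (padicBall p 0 (nuP p lam₂ + 1 - k))ᶜ →
        (∀ i < l, i ≠ t → a i ≠ 0) ∧
        (∀ i < l, i ≠ t → ∀ j < l, j ≠ t → i ≠ j → Disjoint (B i) (B j)) ∧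
        (∀ i < l, i ≠ t → Disjoint (B i) C) ∧
        keplerSet a = (⋃ i ∈ {i : ℕ | i < l ∧ i ≠ t}, B i) ∪ C) := by
  have hult := isUltrametricDist_of_normedAlgebra_padic p L
  have hpr : (0 : ℝ) < p := by exact_mod_cast (Fact.out : p.Prime).pos
  have hval : ∀ {x : L}, x ≠ 0 → ‖x‖ = (p : ℝ) ^ (-nuP p x) := fun hx => norm_eq_zpow_neg_nuP hL hx
  have hne : lam₁ ≠ lam₂ := fun h => hroot 1 one_pos (by rw [h, div_self hlam₂, pow_one])
  obtain ⟨hadd, hmul⟩ := add_mul_of_recurrence hrec hc₁ hc₂ ha hne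
  have H : IsKeplerData p a r s (c₁ / c₂) c₂ lam₁ lam₂ l :=
    { three_le := hp
      c_ne := div_ne_zero hc₁ hc₂
      d_ne := hc₂
      lam₁_ne := hlam₁
      lam₂_ne := hlam₂
      add := hadd
      mul := hmul
      term := fun n => by
        rw [ha, div_pow]
        field_simp
      norm_eq := hnorm
      l_pos := hl.1.1
      pow_ne := hroot l hl.1.1
      pow_le := by
        rw [← zpow_neg_one]
        exact (congrModPow_iff 1 _ _).1 hl.1.2 }
  have hq : ‖(lam₂ / lam₁) ^ l - 1‖ = (p : ℝ) ^ (-k) := by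
    rw [hk]; exact hval (sub_ne_zero.2 H.pow_ne)
  have hD0 : 0 < ‖lam₂ - lam₁‖ := norm_pos_iff.2 H.sub_ne
  have hsep : ∀ {i j : ℕ}, i < l → j < l → i ≠ j →
      ‖(lam₂ / lam₁) ^ i - (lam₂ / lam₁) ^ j‖ = 1 := fun hi hj hij =>
    hl.norm_pow_sub_pow_eq_one hL H.norm_quot hi hj hij
  refine ⟨fun hcl B hB => ?_, fun hcl hl1 => ?_, fun hcl hl2 => ?_⟩
  · have hfar : ∀ i < l, ‖(lam₂ / lam₁) ^ l - 1‖ < ‖c₁ / c₂ + (lam₂ / lam₁) ^ i‖ := by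
      intro i hi
      by_contra h
      exact hcl (H.neg_mem_closure_iff.2 ⟨i, hi, not_lt.1 h⟩)
    have hBi : ∀ i < l, B i = Metric.closedBall (a (i + 1) / a i)
        (‖c₁ / c₂‖ * ‖lam₂ - lam₁‖ * ‖(lam₂ / lam₁) ^ l - 1‖ /
          ‖c₁ / c₂ + (lam₂ / lam₁) ^ i‖ ^ 2) := by
      intro i hi
      rw [hB, padicBall_eq_closedBall, hval H.c_ne, hval H.sub_ne, hq,
        hval (norm_pos_iff.1 (H.radius_pos.trans (hfar i hi))),
        ← zpow_natCast ((p : ℝ) ^ (_ : ℤ)) 2, ← zpow_mul,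
        ← zpow_add₀ hpr.ne', ← zpow_add₀ hpr.ne', ← zpow_sub₀ hpr.ne']
      congr 2
      push_cast
      ring
    refine ⟨fun i hi => (H.ne_zero_iff i).2 (norm_pos_iff.1 (H.radius_pos.trans (hfar i hi))),
      fun i hi j hj hij => ?_, ?_⟩
    · rw [hBi i hi, hBi j hj]
      exact H.disjoint_closedBall (hfar i hi) (hfar j hj) (hsep hi hj hij)
    · rw [H.keplerSet_eq_of_lt hfar]
      exact Set.iUnion₂_congr fun i hi => (hBi i hi).symm
  · obtain ⟨t, htl, ht⟩ := H.neg_mem_closure_iff.1 hcl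
    refine ⟨r / 2, by rw [map_div₀, map_ofNat, hadd], ?_⟩
    have hemp : {i : ℕ | i < l ∧ i ≠ t} = ∅ := by
      ext i
      simp only [Set.mem_ofPred_eq, Set.mem_empty_iff_false, iff_false]
      omega
    have hrad : ‖lam₂ - lam₁‖ / ‖(lam₂ / lam₁) ^ l - 1‖ = (p : ℝ) ^ (1 - (1 + nuP p lam₂)) := by
      have e : (lam₂ / lam₁) ^ l - 1 = (lam₂ - lam₁) / lam₁ := by
        rw [hl1, pow_one, sub_div, div_self hlam₁]
      rw [e, norm_div, div_div_cancel₀ hD0.ne', hnorm, hval hlam₂]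
      congr 1
      ring
    rw [H.keplerSet_eq_of_le ht fun i hi hit => by omega, hemp, Set.biUnion_empty, Set.empty_union,
      compl_padicBall_eq, hrad]
  · have hcongr : ∀ t : ℕ, CongrModPow p k ((lam₂ / lam₁) ^ t) (-(c₁ / c₂)) ↔
        ‖c₁ / c₂ + (lam₂ / lam₁) ^ t‖ ≤ ‖(lam₂ / lam₁) ^ l - 1‖ := fun t => by
      rw [congrModPow_iff, hq, sub_neg_eq_add, add_comm]
    have hone : ∀ {i t : ℕ}, i < l → t < l → i ≠ t →
        ‖c₁ / c₂ + (lam₂ / lam₁) ^ t‖ ≤ ‖(lam₂ / lam₁) ^ l - 1‖ →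
        ‖c₁ / c₂ + (lam₂ / lam₁) ^ i‖ = 1 := by
      intro i t hi htl hit ht
      rw [← hsep hi htl hit]
      apply norm_eq_of_norm_sub_lt
      rw [add_sub_assoc, sub_sub_cancel, hsep hi htl hit]
      exact ht.trans_lt H.radius_lt
    constructor
    · obtain ⟨t, htl, ht⟩ := H.neg_mem_closure_iff.1 hcl
      refine ⟨t, ⟨htl, (hcongr t).2 ht⟩, ?_⟩
      rintro i ⟨hi, hi'⟩
      by_contra hit
      have h1 := hone hi htl hit ht
      exact absurd (h1 ▸ (hcongr i).1 hi') (not_le.2 H.radius_lt)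
    intro t htl ht B hB C hC
    rw [hcongr] at ht
    have hfar : ∀ i < l, i ≠ t →
        ‖(lam₂ / lam₁) ^ l - 1‖ < ‖c₁ / c₂ + (lam₂ / lam₁) ^ i‖ := fun i hi hit => by
      rw [hone hi htl hit ht]
      exact H.radius_lt
    have hBi : ∀ i < l, i ≠ t → B i = Metric.closedBall (a (i + 1) / a i)
        (‖c₁ / c₂‖ * ‖lam₂ - lam₁‖ * ‖(lam₂ / lam₁) ^ l - 1‖ /
          ‖c₁ / c₂ + (lam₂ / lam₁) ^ i‖ ^ 2) := by
      intro i hi hit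
      rw [hB, padicBall_eq_closedBall, H.norm_c_eq_one ht, hone hi htl hit ht, hval H.sub_ne, hq,
        one_mul, one_pow, div_one, ← zpow_add₀ hpr.ne']
      congr 2
      ring
    -- for `l ≥ 2` the quotient of the roots is not congruent to `1`
    have hD : ‖lam₂ - lam₁‖ = ‖lam₂‖ := by
      have h1 := hsep (i := 1) (j := 0) (by omega) (by omega) one_ne_zero
      have e : (lam₂ / lam₁) ^ 1 - (lam₂ / lam₁) ^ 0 = (lam₂ - lam₁) / lam₁ := by
        rw [pow_one, pow_zero, sub_div, div_self hlam₁]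
      rw [e, norm_div, div_eq_one_iff_eq (norm_ne_zero_iff.2 hlam₁), hnorm] at h1
      exact h1
    have hlt : ‖lam₂‖ < ‖lam₂‖ / ‖(lam₂ / lam₁) ^ l - 1‖ := by
      rw [lt_div_iff₀ H.radius_pos]
      exact mul_lt_of_lt_one_right (norm_pos_iff.2 hlam₂) H.radius_lt
    have hCm : ∀ y, y ∈ C ↔ ‖lam₂‖ / ‖(lam₂ / lam₁) ^ l - 1‖ ≤ ‖y‖ := fun y => by
      rw [hC, compl_padicBall_eq, Set.mem_ofPred_eq, sub_zero, hq, hval hlam₂,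
        ← zpow_sub₀ hpr.ne', show 1 - (nuP p lam₂ + 1 - k) = -nuP p lam₂ - -k by ring]
    refine ⟨fun i hi hit =>
      (H.ne_zero_iff i).2 (norm_pos_iff.1 (H.radius_pos.trans (hfar i hi hit))),
      fun i hi hit j hj hjt hij => ?_, fun i hi hit => ?_, ?_⟩
    · rw [hBi i hi hit, hBi j hj hjt]
      exact H.disjoint_closedBall (hfar i hi hit) (hfar j hj hjt) (hsep hi hj hij)
    · rw [hBi i hi hit, Set.disjoint_left]
      intro y hy hyC
      rw [mem_closedBall_iff_norm, H.norm_c_eq_one ht, hone hi htl hit ht, hD, one_mul, one_pow,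
        div_one, ← norm_algebraMap' L (y - _), map_sub] at hy
      rw [hCm, ← norm_algebraMap' L y] at hyC
      have hne' := norm_pos_iff.1 (H.radius_pos.trans (hfar i hi hit))
      have h1 := H.norm_sub_ratio hne'
      rw [H.norm_c_eq_one ht, hone hi htl hit ht, hD, one_mul, div_one] at h1
      have e : algebraMap ℚ_[p] L y = (algebraMap ℚ_[p] L y -
          algebraMap ℚ_[p] L (a (i + 1) / a i)) -
          ((lam₂ - algebraMap ℚ_[p] L (a (i + 1) / a i)) - lam₂) := by ring
      have h2 : ‖algebraMap ℚ_[p] L y‖ ≤ ‖lam₂‖ := by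
        rw [e]
        exact norm_sub_le_of_le_of_le
          (hy.trans (mul_le_of_le_one_right (norm_nonneg _) H.radius_lt.le))
          (norm_sub_le_of_le_of_le h1.le le_rfl)
      exact absurd (hlt.trans_le hyC) (not_lt.2 h2)
    · rw [H.keplerSet_eq_of_le ht hfar]
      congr 1
      · exact Set.iUnion₂_congr fun i hi => (hBi i hi.1 hi.2).symm
      · -- the midpoint `r / 2` has norm at most `‖lam₂‖`, so shifting by it preserves larger norms
        have hm : ‖r / 2‖ ≤ ‖lam₂‖ := by
          rw [← norm_algebraMap' L, map_div₀, map_ofNat, norm_div, norm_two_eq_one p hp, div_one,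
            ← hadd]
          exact norm_add_le_of_le_of_le hnorm.le le_rfl
        ext y
        rw [hCm, Set.mem_ofPred_eq, hD]
        constructor
        · intro h
          rwa [norm_eq_of_norm_sub_lt (x := y) (y := y - r / 2)
            (by rw [sub_sub_cancel]; exact hm.trans_lt (hlt.trans_le h))]
        · intro h
          rwa [norm_eq_of_norm_sub_lt (x := y - r / 2) (y := y)
            (by rw [sub_sub_cancel_left, norm_neg]; exact hm.trans_lt (hlt.trans_le h))]
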